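/- Let $A\in\mathbb R^{n\times n}$, $B\in\mathbb R^{n\times m}$, $b\in\mathbb R^n$ and let $f:\mathbb R^n\times\mathbb R^m\to\mathbb R$ be convex. For $T>0$ and $x\in\mathbb R^n$, consider the problem of minimizing $$J_T(x;u)=\int_0^T f(X(t),u(t))\,dt\in(-\infty,+\infty]$$ over $u\in L^2(0,T;\mathbb R^m)$, where $\dot X=AX+Bu+b$ on $[0,T]$ and $X(0)=x$. A pair $(X,u)$ attaining the infimum is called an optimal pair. The integral turnpike property is said to hold at $x$ with steady pair $(x^*,u^*)\in\mathbb R^n\times\mathbb R^m$ if, for all sufficiently large $T$, there is an optimal pair $(\bar X_T,\bar u_T)$ for the initial state $x$ such that $$\lim_{T\to\infty}\frac1T\int_0^T\bigl[|\bar X_T(t)-x^*|^2+|\bar u_T(t)-u^*|^2\bigr]dt=0 .$$ Let $\mathcal C=\operatorname{im}(B,AB,\dots,A^{n-1}B)$ and $k=\dim\mathcal C$. Let $P_2\in\mathbb R^{n\times(n-k)}$ be a matrix whose columns form an orthonormal basis of $\mathcal C^\perp$, and put $A_{22}=P_2^\top AP_2$. Let $\mathcal G_1$ be the set of real vectors in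 the sum of the generalized eigenspaces in $\mathbb C^{n-k}$ of $A_{22}$ for its eigenvalues with negative real part, and let $\mathcal G_2=\ker A_{22}\subseteq\mathbb R^{n-k}$. Then $\mathcal G_1\cap\mathcal G_2=\{0\}$; let $Q_2:\mathcal G_1\oplus\mathcal G_2\to\mathcal G_2$ be the projection along $\mathcal G_1$. Assume (A1) $b\in\operatorname{im}(A,B)$, or equivalently, $P_2^\top b=A_{22}c$ for some $c\in\mathbb R^{n-k}$, and let $c$ be any vector with $A_{22}c=P_2^\top b$. Put $$\mathcal X=\{x\in\mathbb R^n: P_2^\top x+c\in\mathcal G_1\oplus\mathcal G_2\},$$ and, for $x\in\mathcal X$, $$\mathcal V_x=\{(z,u)\in\mathbb R^n\times\mathbb R^m: Az+Bu+b=0,\ P_2^\top z+c=Q_2(P_2^\top x+c)\}.$$ **Proposition.** If the integral turnpike property holds at $x\in\mathcal X$ with steady pair $(x^*,u^*)$, then $(x^*,u^*)\in\mathcal V_x$ and $$f(x^*,u^*)\le f(z,u)\qquad\text{for all }(z,u)\in\mathcal V_x .$$ -/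

import Mathlib

open Set Filter Topology MeasureTheory

noncomputable section

namespace LinearConvex

/-- `ℝⁿ` with its Euclidean norm. -/
abbrev Vec (n : ℕ) : Type := EuclideanSpace ℝ (Fin n)

/-- The product `M v` of a real matrix and a column vector. -/
abbrev act {p q : Type*} [Fintype p] [Fintype q] [DecidableEq q]
    (M : Matrix p q ℝ) (v : EuclideanSpace ℝ q) : EuclideanSpace ℝ p :=
  Matrix.toEuclideanLin M v

/-- The image of a real matrix. -/
def image {p q : Type*} [Fintype p] [Fintype q] [DecidableEq q] (M : Matrix p q ℝ) :
    Submodule ℝ (EuclideanSpace ℝ p) :=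
  LinearMap.range (Matrix.toEuclideanLin M)

/-! ### The control problem on `[0, T]` -/

/-- `u ∈ L²(0, T; ℝᵐ)`. Only the values of `u` on `[0, T]` matter. -/
def IsControl {m : ℕ} (T : ℝ) (u : ℝ → Vec m) : Prop :=
  MemLp u 2 (volume.restrict (Icc 0 T))

/-- `X` is the (Carathéodory) solution on `[0, T]` of `X' = A X + B u + b`, `X 0 = x`. -/
def IsTrajectory {n m : ℕ} (A : Matrix (Fin n) (Fin n) ℝ) (B : Matrix (Fin n) (Fin m) ℝ)
    (b : Vec n) (T : ℝ) (x : Vec n) (u : ℝ → Vec m) (X : ℝ → Vec n) : Prop :=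
  ContinuousOn X (Icc 0 T) ∧
    ∀ t ∈ Icc 0 T, X t = x + ∫ s in (0 : ℝ)..t, (act A (X s) + act B (u s) + b)

open Classical in
/-- The cost `∫₀ᵀ f (X t, u t) dt`. For convex `f`, a continuous `X` and `u ∈ L²`, the negative part
of the integrand is integrable (`f` has an affine minorant), so the integral always exists in
`(-∞, +∞]`, and it is `+∞` exactly when the integrand is not integrable. -/
def cost {n m : ℕ} (f : Vec n × Vec m → ℝ) (T : ℝ) (X : ℝ → Vec n) (u : ℝ → Vec m) : EReal :=
  if IntervalIntegrable (fun t => f (X t, u t)) volume 0 T then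
    ((∫ t in (0 : ℝ)..T, f (X t, u t) : ℝ) : EReal)
  else ⊤

/-- The value function: the infimum of the cost over all controls in `L²(0, T; ℝᵐ)`. -/
def valueFunction {n m : ℕ} (A : Matrix (Fin n) (Fin n) ℝ) (B : Matrix (Fin n) (Fin m) ℝ)
    (b : Vec n) (f : Vec n × Vec m → ℝ) (T : ℝ) (x : Vec n) : EReal :=
  sInf {J | ∃ (u : ℝ → Vec m) (X : ℝ → Vec n),
    IsControl T u ∧ IsTrajectory A B b T x u X ∧ J = cost f T X u}

/-- `(X, u)` is an optimal pair of the control problem on `[0, T]` with initial state `x`. -/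
def IsOptimalPair {n m : ℕ} (A : Matrix (Fin n) (Fin n) ℝ) (B : Matrix (Fin n) (Fin m) ℝ)
    (b : Vec n) (f : Vec n × Vec m → ℝ) (T : ℝ) (x : Vec n)
    (X : ℝ → Vec n) (u : ℝ → Vec m) : Prop :=
  IsControl T u ∧ IsTrajectory A B b T x u X ∧ cost f T X u = valueFunction A B b f T x

/-- The integral turnpike property at the initial state `x` with steady pair `(xs, us)`: for all
large `T` there is an optimal pair `(X T, u T)` on `[0, T]`, and
`(1 / T) ∫₀ᵀ (|X T t - xs|² + |u T t - us|²) dt → 0` as `T → ∞`. -/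
def HasIntegralTurnpike {n m : ℕ} (A : Matrix (Fin n) (Fin n) ℝ) (B : Matrix (Fin n) (Fin m) ℝ)
    (b : Vec n) (f : Vec n × Vec m → ℝ) (x xs : Vec n) (us : Vec m) : Prop :=
  ∃ (X : ℝ → ℝ → Vec n) (u : ℝ → ℝ → Vec m),
    (∀ᶠ T in atTop, IsOptimalPair A B b f T x (X T) (u T)) ∧
    Tendsto (fun T : ℝ => (1 / T) * ∫ t in (0 : ℝ)..T, (‖X T t - xs‖ ^ 2 + ‖u T t - us‖ ^ 2))
      atTop (𝓝 0)

/-! ### The uncontrollable part of the system -/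

/-- The block matrix `(B, A B, …, A ^ (n - 1) B)`. -/
def kalmanMatrix {n m : ℕ} (A : Matrix (Fin n) (Fin n) ℝ) (B : Matrix (Fin n) (Fin m) ℝ) :
    Matrix (Fin n) (Fin n × Fin m) ℝ :=
  Matrix.of fun i p => (A ^ (p.1 : ℕ) * B) i p.2

/-- The controllable subspace of `(A, B)`. -/
def controllableSubspace {n m : ℕ} (A : Matrix (Fin n) (Fin n) ℝ)
    (B : Matrix (Fin n) (Fin m) ℝ) : Submodule ℝ (Vec n) :=
  image (kalmanMatrix A B)

/-- The matrix `P₂` whose columns are the vectors of an orthonormal basis of a subspace (used for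
the orthogonal complement of the controllable subspace). -/
def basisMatrix {n l : ℕ} {S : Submodule ℝ (Vec n)} (v : OrthonormalBasis (Fin l) ℝ S) :
    Matrix (Fin n) (Fin l) ℝ :=
  Matrix.of fun i j => (v j : Vec n) i

/-- The lower right block `A₂₂ = P₂ᵀ A P₂` of `Pᵀ A P`. -/
def uncontrollableBlock {n l : ℕ} (A : Matrix (Fin n) (Fin n) ℝ) (P₂ : Matrix (Fin n) (Fin l) ℝ) :
    Matrix (Fin l) (Fin l) ℝ :=
  P₂.transpose * A * P₂

/-- A real matrix as a linear map of `ℂˡ`. -/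
def complexify {l : ℕ} (M : Matrix (Fin l) (Fin l) ℝ) : Module.End ℂ (Fin l → ℂ) :=
  Matrix.toLin' (M.map (fun r : ℝ => (r : ℂ)))

/-- The sum in `ℂˡ` of the generalized eigenspaces of `M` for its eigenvalues with negative real
part. -/
def complexStableSpace {l : ℕ} (M : Matrix (Fin l) (Fin l) ℝ) : Submodule ℂ (Fin l → ℂ) :=
  ⨆ μ ∈ {μ : ℂ | μ ∈ spectrum ℂ (complexify M) ∧ μ.re < 0}, (complexify M).maxGenEigenspace μ

/-- `𝒢₁`: the real vectors in `complexStableSpace M`. -/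
def stableSpace {l : ℕ} (M : Matrix (Fin l) (Fin l) ℝ) : Submodule ℝ (Vec l) where
  carrier := {y | (fun i => (y i : ℂ)) ∈ complexStableSpace M}
  zero_mem' := by
    have h : (fun i => (((0 : Vec l) i : ℝ) : ℂ)) = 0 := by ext i; simp
    rw [Set.mem_ofPred_eq, h]
    exact Submodule.zero_mem _
  add_mem' := by
    intro y z hy hz
    have h : (fun i => (((y + z) i : ℝ) : ℂ)) = (fun i => (y i : ℂ)) + fun i => (z i : ℂ) := by
      ext i; simp
    rw [Set.mem_ofPred_eq, h]
    exact Submodule.add_mem _ hy hz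
  smul_mem' := by
    intro r y hy
    have h : (fun i => (((r • y) i : ℝ) : ℂ)) = (r : ℂ) • fun i => (y i : ℂ) := by
      ext i; simp
    rw [Set.mem_ofPred_eq, h]
    exact Submodule.smul_mem _ _ hy

/-- `𝒢₂`: the kernel of `M`. -/
def kernelSpace {l : ℕ} (M : Matrix (Fin l) (Fin l) ℝ) : Submodule ℝ (Vec l) :=
  LinearMap.ker (Matrix.toEuclideanLin M)

theorem disjoint_stableSpace_kernelSpace {l : ℕ} (M : Matrix (Fin l) (Fin l) ℝ) :
    Disjoint (stableSpace M) (kernelSpace M) := by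
  rw [Submodule.disjoint_def]
  intro y hy hy0
  have hy1 : (fun i => (y i : ℂ)) ∈ complexStableSpace M := hy
  have hker : complexify M (fun i => (y i : ℂ)) = 0 := by
    have h : Matrix.toEuclideanLin M y = 0 := hy0
    ext i
    have hi : (Matrix.toEuclideanLin M y) i = (0 : ℝ) := by rw [h]; rfl
    rw [Matrix.toLpLin_apply] at hi
    simp only [Matrix.mulVec, dotProduct] at hi
    simp only [complexify, Matrix.toLin'_apply, Matrix.mulVec, dotProduct, Matrix.map_apply,
      Pi.zero_apply]
    exact_mod_cast hi
  have h0 : (fun i => (y i : ℂ)) ∈ (complexify M).maxGenEigenspace 0 := by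
    rw [Module.End.mem_maxGenEigenspace]
    exact ⟨1, by simpa using hker⟩
  have hle : complexStableSpace M ≤ ⨆ μ, ⨆ _ : μ ≠ 0, (complexify M).maxGenEigenspace μ := by
    refine iSup₂_le fun μ hμ => ?_
    refine le_iSup₂_of_le μ ?_ le_rfl
    rintro rfl
    simpa using hμ.2
  have hd := (complexify M).independent_maxGenEigenspace 0
  have hz := Submodule.disjoint_def.1 hd _ h0 (hle hy1)
  ext i
  have hi := congrFun hz i
  simpa using hi

theorem isCompl_stableSpace_kernelSpace {l : ℕ} (M : Matrix (Fin l) (Fin l) ℝ) :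
    IsCompl ((kernelSpace M).submoduleOf (stableSpace M ⊔ kernelSpace M))
      ((stableSpace M).submoduleOf (stableSpace M ⊔ kernelSpace M)) := by
  constructor
  · rw [Submodule.disjoint_def]
    intro y hy2 hy1
    exact Subtype.ext (Submodule.disjoint_def.1 (disjoint_stableSpace_kernelSpace M) _ hy1 hy2)
  · rw [codisjoint_iff, ← Submodule.submoduleOf_sup_of_le le_sup_right le_sup_left, sup_comm]
    exact Submodule.submoduleOf_self _

/-- `Q₂`: the projection of `𝒢₁ ⊕ 𝒢₂` onto `𝒢₂` along `𝒢₁`. -/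
def projKernel {l : ℕ} (M : Matrix (Fin l) (Fin l) ℝ) :
    ↥(stableSpace M ⊔ kernelSpace M) →ₗ[ℝ] ↥(stableSpace M ⊔ kernelSpace M) :=
  Submodule.projection _ _ (isCompl_stableSpace_kernelSpace M)

/-! ### The static problem -/

/-- The set `𝒳` of feasible initial states: `P₂ᵀ x + c ∈ 𝒢₁ ⊕ 𝒢₂`. -/
def feasibleStates {n l : ℕ} (A : Matrix (Fin n) (Fin n) ℝ) (P₂ : Matrix (Fin n) (Fin l) ℝ)
    (c : Vec l) : Set (Vec n) :=
  {x | act P₂.transpose x + c ∈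
    stableSpace (uncontrollableBlock A P₂) ⊔ kernelSpace (uncontrollableBlock A P₂)}

/-- The constraint set `𝒱ₓ` of a feasible initial state `x`: all `(z, u)` with `A z + B u + b = 0`
and `P₂ᵀ z + c = Q₂ (P₂ᵀ x + c)`. -/
def constraintSet {n m l : ℕ} (A : Matrix (Fin n) (Fin n) ℝ) (B : Matrix (Fin n) (Fin m) ℝ)
    (b : Vec n) (P₂ : Matrix (Fin n) (Fin l) ℝ) (c : Vec l)
    (x : Vec n) (hx : x ∈ feasibleStates A P₂ c) : Set (Vec n × Vec m) :=
  {p | act A p.1 + act B p.2 + b = 0 ∧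
    act P₂.transpose p.1 + c =
      (projKernel (uncontrollableBlock A P₂) ⟨act P₂.transpose x + c, hx⟩ : Vec l)}

end LinearConvex

end

/-! Write $R=P_2^\top$, $M=A_{22}$ and $g=Q_2(Rx+c)$. Since $\mathcal C=\ker R$ is $A$-invariant and
contains $\operatorname{im}B$, one has $RB=0$ and $RA=MR$. With $Mc=Rb$, every trajectory makes
$RX+c$ a solution of $y'=My$ that does not depend on the control
(`IsTrajectory.uncontrollable_part`). It starts at $g$ plus a vector of $\mathcal G_1$, hence tends
to $g$.

Membership in $\mathcal V_x$: the turnpike property provides times $\tau(T)\in[T/2,T]$ with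
$X_T(\tau(T))\to x^*$. Passing to the limit in $RX+c$ gives $Rx^*+c=g$. Dividing the integrated
dynamics on $[0,\tau(T)]$ by $\tau(T)$ gives $Ax^*+Bu^*+b=0$ (`act_add_act_add_eq_zero`).

Optimality: for $(z,w)\in\mathcal V_x$ there is a competitor $(z+\xi,w+\eta)$ started at $x$ with
$\xi,\eta\to0$. Its average cost tends to $f(z,w)$, while by Jensen the average cost of the optimal
pair is at least $f$ at its time average, which tends to $f(x^*,u^*)$ (`le_of_equilibrium`).

The competitor exists because $x-z$ is the sum of the initial state of a decaying free solution,
lifted from $\mathcal G_1$ (`exists_decaying_lift`), and a vector of $\mathcal C$. Vectors of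
$\mathcal C$ are steered to $0$ by superposing exponentials $e^{rt}(p,w)$ with $r<0$ and $rp=Ap+Bw$
(`controllableSubspace_le_decayingStates`). -/

noncomputable section

namespace LinearConvex

/-! ### Decaying solutions of linear systems -/

section Decaying

variable {E U : Type*} [NormedAddCommGroup E] [NormedSpace ℝ E]
  [NormedAddCommGroup U] [NormedSpace ℝ U]

/-- The states from which some continuous control `η → 0` produces a solution `ξ → 0` of
`ξ' = A ξ + B η`. -/
def decayingStates (A : E →L[ℝ] E) (B : U →L[ℝ] E) : Submodule ℝ E where
  carrier := {e | ∃ (ξ : ℝ → E) (η : ℝ → U), Continuous η ∧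
    (∀ t, HasDerivAt ξ (A (ξ t) + B (η t)) t) ∧ ξ 0 = e ∧
    Tendsto ξ atTop (𝓝 0) ∧ Tendsto η atTop (𝓝 0)}
  zero_mem' := ⟨fun _ => 0, fun _ => 0, continuous_const,
    fun t => by simpa using hasDerivAt_const t (0 : E), rfl, tendsto_const_nhds, tendsto_const_nhds⟩
  add_mem' := by
    rintro _ _ ⟨ξ₁, η₁, hc₁, hd₁, rfl, hξ₁, hη₁⟩ ⟨ξ₂, η₂, hc₂, hd₂, rfl, hξ₂, hη₂⟩
    refine ⟨fun t => ξ₁ t + ξ₂ t, fun t => η₁ t + η₂ t, hc₁.add hc₂, fun t => ?_, rfl,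
      by simpa using hξ₁.add hξ₂, by simpa using hη₁.add hη₂⟩
    refine ((hd₁ t).add (hd₂ t)).congr_deriv ?_
    simp only [map_add]
    abel
  smul_mem' := by
    rintro r _ ⟨ξ, η, hc, hd, rfl, hξ, hη⟩
    refine ⟨fun t => r • ξ t, fun t => r • η t, hc.const_smul r, fun t => ?_, rfl,
      by simpa using hξ.const_smul r, by simpa using hη.const_smul r⟩
    refine ((hd t).const_smul r).congr_deriv ?_
    simp only [map_smul, smul_add]

theorem tendsto_exp_mul_atTop_of_neg {r : ℝ} (hr : r < 0) :
    Tendsto (fun t : ℝ => Real.exp (r * t)) atTop (𝓝 0) :=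
  Real.tendsto_exp_atBot.comp (Tendsto.const_mul_atTop_of_neg hr tendsto_id)

/-- The pair $e^{rt}(p,w)$ solves the controlled system exactly when $rp=Ap+Bw$. -/
theorem mem_decayingStates_of_smul_eq {A : E →L[ℝ] E} {B : U →L[ℝ] E} {r : ℝ} (hr : r < 0)
    {p : E} {w : U} (h : r • p = A p + B w) : p ∈ decayingStates A B := by
  refine ⟨fun t => Real.exp (r * t) • p, fun t => Real.exp (r * t) • w, by fun_prop, fun t => ?_,
    by simp, by simpa using (tendsto_exp_mul_atTop_of_neg hr).smul_const p,
    by simpa using (tendsto_exp_mul_atTop_of_neg hr).smul_const w⟩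
  have h1 : HasDerivAt (fun t : ℝ => Real.exp (r * t)) (Real.exp (r * t) * r) t := by
    simpa using ((hasDerivAt_id t).const_mul r).exp
  refine (h1.smul_const p).congr_deriv ?_
  rw [mul_smul, h, map_smul, map_smul, smul_add]

/-- The span of the vectors `(r - A)⁻¹ B w` with `r < 0`. -/
def resolventSpan (A : E →L[ℝ] E) (B : U →L[ℝ] E) : Submodule ℝ E :=
  Submodule.span ℝ {p | ∃ r < (0 : ℝ), ∃ w, r • p = A p + B w}

theorem resolventSpan_le_decayingStates (A : E →L[ℝ] E) (B : U →L[ℝ] E) :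
    resolventSpan A B ≤ decayingStates A B := by
  refine Submodule.span_le.2 ?_
  rintro p ⟨r, hr, w, h⟩
  exact mem_decayingStates_of_smul_eq hr h

variable [FiniteDimensional ℝ E]

/-- An eigenvalue of $A$ has modulus at most $\|A\|$, so $r-A$ is injective, hence surjective in
finite dimension. -/
theorem exists_smul_sub_apply_eq (A : E →L[ℝ] E) {r : ℝ} (hr : ‖A‖ < |r|) (y : E) :
    ∃ p, r • p = A p + y := by
  have hinj : Function.Injective (r • LinearMap.id - (A : E →ₗ[ℝ] E) : E →ₗ[ℝ] E) := by
    rw [injective_iff_map_eq_zero]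
    intro p hp
    have h1 : r • p = A p := by simpa [sub_eq_zero] using hp
    by_contra h0
    have h2 : |r| * ‖p‖ ≤ ‖A‖ * ‖p‖ := by
      rw [← Real.norm_eq_abs, ← norm_smul, h1]
      exact A.le_opNorm p
    exact absurd (le_of_mul_le_mul_right h2 (norm_pos_iff.2 h0)) (not_le.2 hr)
  obtain ⟨p, hp⟩ := LinearMap.injective_iff_surjective.1 hinj y
  refine ⟨p, ?_⟩
  have : r • p - A p = y := by simpa using hp
  rw [← this]
  abel

/-- As $r\to-\infty$, the solution $p_r$ of $rp_r=Ap_r+Bw$ tends to $0$, so $rp_r\to Bw$. A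
finite-dimensional span is closed and keeps the limit. -/
theorem range_le_resolventSpan (A : E →L[ℝ] E) (B : U →L[ℝ] E) (w : U) :
    B w ∈ resolventSpan A B := by
  -- The values $r=-(\|A\|+1+k)$ are negative and satisfy $|r|-\|A\|=k+1$, which yields
  -- $\|p_k\|\le\|Bw\|/(k+1)$.
  have hex : ∀ k : ℕ, ∃ p, (-(‖A‖ + 1 + k)) • p = A p + B w := fun k =>
    exists_smul_sub_apply_eq A (by
      rw [abs_neg, abs_of_nonneg (by positivity)]
      have : (0 : ℝ) ≤ k := k.cast_nonneg
      linarith) _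
  choose p hp using hex
  have hbound : ∀ k : ℕ, ‖p k‖ ≤ ‖B w‖ / (k + 1) := by
    intro k
    rw [le_div_iff₀ (by positivity)]
    have h1 : (‖A‖ + 1 + k) * ‖p k‖ ≤ ‖A‖ * ‖p k‖ + ‖B w‖ := by
      calc (‖A‖ + 1 + k) * ‖p k‖ = ‖(-(‖A‖ + 1 + k)) • p k‖ := by
            rw [norm_smul, norm_neg, Real.norm_of_nonneg (by positivity)]
        _ ≤ ‖A (p k)‖ + ‖B w‖ := by rw [hp]; exact norm_add_le _ _
        _ ≤ _ := by gcongr; exact A.le_opNorm _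
    nlinarith
  have hp0 : Tendsto p atTop (𝓝 0) := by
    refine squeeze_zero_norm hbound ?_
    simpa [div_eq_mul_inv] using
      (tendsto_one_div_add_atTop_nhds_zero_nat (𝕜 := ℝ)).const_mul ‖B w‖
  have hlim : Tendsto (fun k : ℕ => (-(‖A‖ + 1 + k)) • p k) atTop (𝓝 (B w)) := by
    have h1 : Tendsto (fun k => A (p k) + B w) atTop (𝓝 (A 0 + B w)) :=
      ((A.continuous.tendsto 0).comp hp0).add_const _
    rw [map_zero, zero_add] at h1
    exact h1.congr fun k => (hp k).symm
  refine (resolventSpan A B).closed_of_finiteDimensional.mem_of_tendsto hlim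
    (Eventually.of_forall fun k => Submodule.smul_mem _ _ (Submodule.subset_span ?_))
  exact ⟨-(‖A‖ + 1 + k), by
    have := norm_nonneg A
    have : (0 : ℝ) ≤ k := k.cast_nonneg
    linarith, w, hp k⟩

/-- On generators $Ap=rp-Bw$, and both terms lie in the span. With `range_le_resolventSpan` the span
therefore contains every $A^kBw$. -/
theorem apply_mem_resolventSpan (A : E →L[ℝ] E) (B : U →L[ℝ] E) {p : E}
    (hp : p ∈ resolventSpan A B) : A p ∈ resolventSpan A B := by
  induction hp using Submodule.span_induction with
  | mem p h =>
    obtain ⟨r, hr, w, h⟩ := h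
    rw [← sub_eq_of_eq_add h]
    exact Submodule.sub_mem _ (Submodule.smul_mem _ _ (Submodule.subset_span ⟨r, hr, w, h⟩))
      (range_le_resolventSpan A B w)
  | zero => simp
  | add p q _ _ hp hq => rw [map_add]; exact Submodule.add_mem _ hp hq
  | smul r p _ hp => rw [map_smul]; exact Submodule.smul_mem _ _ hp

/-- Controllable states can be steered to the origin asymptotically. -/
theorem pow_apply_mem_decayingStates (A : E →L[ℝ] E) (B : U →L[ℝ] E) (k : ℕ) (w : U) :
    (A ^ k) (B w) ∈ decayingStates A B := by
  refine resolventSpan_le_decayingStates A B ?_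
  induction k with
  | zero => exact range_le_resolventSpan A B w
  | succ k ih =>
    rw [pow_succ']
    exact apply_mem_resolventSpan A B ih

end Decaying

/-! ### Generalized eigenvectors: decaying solutions and lifting through surjections -/

section Complex

variable {V W : Type*} [NormedAddCommGroup V] [NormedSpace ℂ V]
  [NormedAddCommGroup W] [NormedSpace ℂ W]

theorem tendsto_pow_mul_cexp_of_re_neg {μ : ℂ} (hμ : μ.re < 0) (k : ℕ) :
    Tendsto (fun t : ℝ => ((t ^ k : ℝ) : ℂ) * Complex.exp (μ * t)) atTop (𝓝 0) := by
  rw [tendsto_zero_iff_norm_tendsto_zero]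
  have h := (Real.tendsto_pow_mul_exp_neg_atTop_nhds_zero k).comp
    (tendsto_id.const_mul_atTop (neg_pos.2 hμ))
  have h2 := (h.const_mul ((-μ.re) ^ k)⁻¹)
  rw [mul_zero] at h2
  refine h2.congr' ?_
  filter_upwards [eventually_ge_atTop 0] with t ht
  have hne : (-μ.re) ^ k ≠ 0 := pow_ne_zero _ (neg_pos.2 hμ).ne'
  simp only [Function.comp, id, norm_mul, Complex.norm_real, Complex.norm_exp, norm_pow,
    Real.norm_of_nonneg ht, Complex.mul_re, Complex.ofReal_re, Complex.ofReal_im, mul_zero,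
    sub_zero, ← neg_mul, neg_neg, mul_pow]
  field_simp

/-- The solution `t ↦ exp (t f) v` of `φ' = f φ` started at a generalized eigenvector `v`. -/
theorem exists_decaying_solution_of_mem_maxGenEigenspace (f : Module.End ℂ V) {μ : ℂ}
    (hμ : μ.re < 0) {v : V} (hv : v ∈ f.maxGenEigenspace μ) :
    ∃ φ : ℝ → V, (∀ t, HasDerivAt φ (f (φ t)) t) ∧ φ 0 = v ∧ Tendsto φ atTop (𝓝 0) := by
  rw [Module.End.mem_maxGenEigenspace] at hv
  obtain ⟨K, hK⟩ := hv
  set N : Module.End ℂ V := f - μ • 1 with hN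
  have hf : ∀ y, f y = μ • y + N y := fun y => by simp [hN]
  -- The functions $e_k(t)=t^ke^{\mu t}/k!$ satisfy $e_{k+1}'=\mu e_{k+1}+e_k$, so $\sum_k e_kN^kv$
  -- is the exponential series, finite because $N^Kv=0$.
  let e : ℕ → ℝ → ℂ := fun k t => (((t ^ k : ℝ) : ℂ) * Complex.exp (μ * t)) / (k.factorial : ℂ)
  have hexp : ∀ t : ℝ, HasDerivAt (fun t : ℝ => Complex.exp (μ * t)) (Complex.exp (μ * t) * μ) t :=
    fun t => by simpa using ((hasDerivAt_id (t : ℂ)).const_mul μ).cexp.comp_ofReal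
  have he0 : ∀ t, HasDerivAt (e 0) (μ * e 0 t) t := fun t => by
    simpa [e, mul_comm] using hexp t
  have hes : ∀ k t, HasDerivAt (e (k + 1)) (μ * e (k + 1) t + e k t) t := fun k t => by
    have h1 : HasDerivAt (fun t : ℝ => ((t ^ (k + 1) : ℝ) : ℂ))
        ((((k + 1 : ℕ) : ℝ) * t ^ k : ℝ) : ℂ) t := by
      simpa using (hasDerivAt_pow (k + 1) t).ofReal_comp
    refine ((h1.mul (hexp t)).div_const _).congr_deriv ?_
    have h2 : (k.factorial : ℂ) ≠ 0 := by exact_mod_cast k.factorial_ne_zero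
    have h3 : ((k : ℂ) + 1) ≠ 0 := by exact_mod_cast k.succ_ne_zero
    simp only [e, Nat.factorial_succ]
    push_cast
    field_simp
    ring
  -- The term $k=K$ vanishes; keeping it makes the sum nonempty and lets $N$ act as an index shift.
  refine ⟨fun t => ∑ k ∈ Finset.range (K + 1), e k t • (N ^ k) v, fun t => ?_, ?_, ?_⟩
  · have hd : HasDerivAt (fun t => ∑ k ∈ Finset.range (K + 1), e k t • (N ^ k) v)
        (∑ k ∈ Finset.range K, (μ * e (k + 1) t + e k t) • (N ^ (k + 1)) v
          + (μ * e 0 t) • (N ^ 0) v) t := by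
      simp only [Finset.sum_range_succ' _ K]
      exact (HasDerivAt.fun_sum fun k _ => (hes k t).smul_const _).add ((he0 t).smul_const _)
    refine hd.congr_deriv ?_
    rw [hf]
    have hNs : N (∑ k ∈ Finset.range (K + 1), e k t • (N ^ k) v)
        = ∑ k ∈ Finset.range K, e k t • (N ^ (k + 1)) v := by
      rw [Finset.sum_range_succ, hK, smul_zero, add_zero, map_sum]
      refine Finset.sum_congr rfl fun k _ => ?_
      rw [map_smul, pow_succ']
      rfl
    beta_reduce
    rw [hNs, Finset.sum_range_succ', smul_add, Finset.smul_sum]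
    simp only [add_smul, mul_smul, Finset.sum_add_distrib]
    abel
  · beta_reduce
    rw [Finset.sum_range_succ', Finset.sum_eq_zero fun k _ => by simp [e]]
    simp [e]
  · rw [← Finset.sum_const_zero (s := Finset.range (K + 1))]
    refine tendsto_finsetSum _ fun k _ => ?_
    have := ((tendsto_pow_mul_cexp_of_re_neg hμ k).div_const (k.factorial : ℂ)).smul_const
      ((N ^ k) v)
    rwa [zero_div, zero_smul] at this

/-- A surjective map intertwining two endomorphisms maps generalized eigenspaces onto generalized
eigenspaces. -/
theorem exists_mem_maxGenEigenspace_of_surjective [FiniteDimensional ℂ V] [FiniteDimensional ℂ W]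
    {f : Module.End ℂ V} {g : Module.End ℂ W} {π : V →ₗ[ℂ] W} (hπ : Function.Surjective π)
    (hfg : ∀ v, π (f v) = g (π v)) {μ : ℂ} {w : W} (hw : w ∈ g.maxGenEigenspace μ) :
    ∃ v ∈ f.maxGenEigenspace μ, π v = w := by
  have hpow : ∀ (k : ℕ) (v : V), π (((f - μ • (1 : Module.End ℂ V)) ^ k) v) = ((g - μ • (1 : Module.End ℂ W)) ^ k) (π v) := by
    intro k
    induction k with
    | zero => simp
    | succ k ih => intro v; simp [pow_succ, ih, hfg]
  rw [Module.End.mem_maxGenEigenspace] at hw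
  obtain ⟨K, hK⟩ := hw
  -- Fitting decomposition: for large $N$ both spaces split into kernel and range of the $N$th
  -- powers. A preimage of $w$ is replaced by its kernel component.
  obtain ⟨N, hNf, hNg, hNK⟩ := ((LinearMap.eventually_isCompl_ker_pow_range_pow (f - μ • 1)).and
    ((LinearMap.eventually_isCompl_ker_pow_range_pow (g - μ • 1)).and
      (eventually_ge_atTop K))).exists
  obtain ⟨u, rfl⟩ := hπ w
  obtain ⟨u₀, hu₀, _, ⟨q, rfl⟩, rfl⟩ := Submodule.mem_sup.1
    (hNf.sup_eq_top ▸ Submodule.mem_top : u ∈ _)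
  rw [LinearMap.mem_ker] at hu₀
  refine ⟨u₀, (Module.End.mem_maxGenEigenspace _ _ _).2 ⟨N, hu₀⟩, ?_⟩
  -- The image of the range component lies in the range of $(g-\mu)^N$, and also in its kernel,
  -- since $w$ and the image of the kernel component do; hence it is $0$.
  have hz : π (((f - μ • (1 : Module.End ℂ V)) ^ N) q) = 0 := by
    refine Submodule.disjoint_def.1 hNg.disjoint _ ?_ ⟨π q, (hpow N q).symm⟩
    have h1 : ((g - μ • (1 : Module.End ℂ W)) ^ N) (π (u₀ + ((f - μ • (1 : Module.End ℂ V)) ^ N) q)) = 0 := by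
      rw [← Nat.sub_add_cancel hNK, pow_add, Module.End.mul_apply, Nat.sub_add_cancel hNK, hK,
        map_zero]
    rw [map_add, map_add, ← hpow, hu₀, map_zero, zero_add] at h1
    exact h1
  rw [map_add, hz, add_zero]

end Complex

/-! ### The controllable subspace and its orthogonal complement -/

section Block

theorem act_mul {p q r : Type*} [Fintype p] [Fintype q] [Fintype r] [DecidableEq q]
    [DecidableEq r] (M : Matrix p q ℝ) (N : Matrix q r ℝ) (v : EuclideanSpace ℝ r) :
    act (M * N) v = act M (act N v) := by
  ext i
  simp [act, Matrix.toLpLin_apply, Matrix.mulVec_mulVec]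

theorem act_sub {p q : Type*} [Fintype p] [Fintype q] [DecidableEq q] (M : Matrix p q ℝ)
    (v w : EuclideanSpace ℝ q) : act M (v - w) = act M v - act M w :=
  map_sub _ v w

theorem act_add {p q : Type*} [Fintype p] [Fintype q] [DecidableEq q] (M : Matrix p q ℝ)
    (v w : EuclideanSpace ℝ q) : act M (v + w) = act M v + act M w :=
  map_add _ v w

theorem act_one {q : Type*} [Fintype q] [DecidableEq q] (v : EuclideanSpace ℝ q) :
    act (1 : Matrix q q ℝ) v = v := by
  ext i
  simp [act]

theorem act_apply {p q : Type*} [Fintype p] [Fintype q] [DecidableEq q] (M : Matrix p q ℝ)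
    (v : EuclideanSpace ℝ q) (i : p) : act M v i = ∑ j, M i j * v j := by
  simp [act, Matrix.toLpLin_apply, Matrix.mulVec, dotProduct]

/-- A matrix as a continuous linear map between Euclidean spaces. -/
def actL {p q : Type*} [Fintype p] [Fintype q] [DecidableEq q] (M : Matrix p q ℝ) :
    EuclideanSpace ℝ q →L[ℝ] EuclideanSpace ℝ p :=
  LinearMap.toContinuousLinearMap (Matrix.toEuclideanLin M)

theorem actL_apply {p q : Type*} [Fintype p] [Fintype q] [DecidableEq q] (M : Matrix p q ℝ)
    (v : EuclideanSpace ℝ q) : actL M v = act M v := rfl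

variable {n m l : ℕ} (A : Matrix (Fin n) (Fin n) ℝ) (B : Matrix (Fin n) (Fin m) ℝ)

theorem act_kalmanMatrix (y : EuclideanSpace ℝ (Fin n × Fin m)) :
    act (kalmanMatrix A B) y =
      ∑ k : Fin n, act (A ^ (k : ℕ) * B) (WithLp.toLp 2 fun j => y (k, j)) := by
  ext i
  rw [act_apply, Fintype.sum_prod_type, WithLp.ofLp_sum, Finset.sum_apply]
  refine Finset.sum_congr rfl fun k _ => ?_
  rw [act_apply]
  rfl

theorem controllableSubspace_le {D : Submodule ℝ (Vec n)}
    (hD : ∀ (k : ℕ) w, act (A ^ k * B) w ∈ D) : controllableSubspace A B ≤ D := by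
  rintro _ ⟨y, rfl⟩
  have := act_kalmanMatrix A B y
  rw [act] at this
  rw [this]
  exact Submodule.sum_mem _ fun k _ => hD k _

theorem act_pow_mul_mem_controllableSubspace_of_lt {k : ℕ} (hk : k < n) (w : Vec m) :
    act (A ^ k * B) w ∈ controllableSubspace A B := by
  refine ⟨WithLp.toLp 2 fun p => if p.1 = ⟨k, hk⟩ then w p.2 else 0, ?_⟩
  have h := act_kalmanMatrix A B (WithLp.toLp 2 fun p => if p.1 = ⟨k, hk⟩ then w p.2 else 0)
  rw [act] at h
  rw [h, Finset.sum_eq_single ⟨k, hk⟩]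
  · simp
  · intro b _ hb
    have : (WithLp.toLp 2 fun j : Fin m => if b = ⟨k, hk⟩ then w j else 0 : Vec m) = 0 := by
      ext j; simp [hb]
    simp only [this, map_zero]
  · simp

/-- By Cayley–Hamilton, $A^k$ is a polynomial in $A$ of degree less than $n$. -/
theorem act_pow_mul_mem_controllableSubspace (k : ℕ) (w : Vec m) :
    act (A ^ k * B) w ∈ controllableSubspace A B := by
  have hdeg : (Polynomial.X ^ k %ₘ A.charpoly).degree < (n : WithBot ℕ) := by
    have := Polynomial.degree_modByMonic_lt (Polynomial.X ^ k) A.charpoly_monic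
    rwa [Matrix.charpoly_degree_eq_dim, Fintype.card_fin] at this
  rw [Matrix.pow_eq_aeval_mod_charpoly]
  by_cases h0 : Polynomial.X ^ k %ₘ A.charpoly = 0
  · simp [h0, act]
  rw [Polynomial.aeval_eq_sum_range' ((Polynomial.natDegree_lt_iff_degree_lt h0).2 hdeg),
    Matrix.sum_mul, act, map_sum, LinearMap.sum_apply]
  refine Submodule.sum_mem _ fun i hi => ?_
  rw [Matrix.smul_mul, map_smul, LinearMap.smul_apply]
  exact Submodule.smul_mem _ _
    (act_pow_mul_mem_controllableSubspace_of_lt A B (Finset.mem_range.1 hi) w)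

theorem act_mem_controllableSubspace {x : Vec n} (hx : x ∈ controllableSubspace A B) :
    act A x ∈ controllableSubspace A B := by
  refine controllableSubspace_le A B (D := (controllableSubspace A B).comap
    (Matrix.toEuclideanLin A)) (fun k w => ?_) hx
  rw [Submodule.mem_comap]
  have := act_pow_mul_mem_controllableSubspace A B (k + 1) w
  rwa [pow_succ', Matrix.mul_assoc, act_mul] at this

theorem controllableSubspace_le_decayingStates :
    controllableSubspace A B ≤ decayingStates (actL A) (actL B) := by
  refine controllableSubspace_le A B fun k w => ?_
  have h : ∀ (k : ℕ) y, ((actL A) ^ k) y = act (A ^ k) y := by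
    intro k
    induction k with
    | zero => intro y; simp [act_one]
    | succ k ih => intro y; rw [pow_succ', pow_succ', act_mul, ← ih]; rfl
  have := pow_apply_mem_decayingStates (actL A) (actL B) k w
  rwa [h, actL_apply, ← act_mul] at this

variable {S : Submodule ℝ (Vec n)} (v : OrthonormalBasis (Fin l) ℝ S)

theorem act_basisMatrix_transpose_apply (x : Vec n) (j : Fin l) :
    act (basisMatrix v).transpose x j = inner ℝ (v j : Vec n) x := by
  rw [act_apply, PiLp.inner_apply]
  refine Finset.sum_congr rfl fun i _ => ?_
  simp [basisMatrix, mul_comm]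

theorem basisMatrix_transpose_mul_self : (basisMatrix v).transpose * basisMatrix v = 1 := by
  ext i j
  have h := orthonormal_iff_ite.1 v.orthonormal i j
  rw [Submodule.coe_inner, PiLp.inner_apply] at h
  rw [Matrix.mul_apply, Matrix.one_apply, ← h]
  refine Finset.sum_congr rfl fun i _ => ?_
  simp [basisMatrix, mul_comm]

theorem act_basisMatrix_transpose_eq_zero_iff {x : Vec n} :
    act (basisMatrix v).transpose x = 0 ↔ x ∈ Sᗮ := by
  rw [Submodule.mem_orthogonal]
  constructor
  · intro h y hy
    have h1 := congrArg (Subtype.val) (v.sum_repr ⟨y, hy⟩)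
    simp only [Submodule.coe_sum, Submodule.coe_smul] at h1
    rw [← h1, sum_inner]
    refine Finset.sum_eq_zero fun j _ => ?_
    rw [inner_smul_left, ← act_basisMatrix_transpose_apply, h]
    simp
  · intro h
    ext j
    rw [act_basisMatrix_transpose_apply]
    exact h _ (v j).2

variable (w : OrthonormalBasis (Fin l) ℝ ↥(controllableSubspace A B)ᗮ)

theorem act_basisMatrix_transpose_eq_zero_iff_mem_controllableSubspace {x : Vec n} :
    act (basisMatrix w).transpose x = 0 ↔ x ∈ controllableSubspace A B := by
  rw [act_basisMatrix_transpose_eq_zero_iff, Submodule.orthogonal_orthogonal]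

theorem act_basisMatrix_transpose_act_input (u : Vec m) :
    act (basisMatrix w).transpose (act B u) = 0 := by
  rw [act_basisMatrix_transpose_eq_zero_iff_mem_controllableSubspace]
  simpa using act_pow_mul_mem_controllableSubspace A B 0 u

/-- The vector $x-P_2P_2^\top x$ is killed by $P_2^\top$, hence lies in $\mathcal C$. Applying $A$
keeps it there, so $P_2^\top A$ kills it too. -/
theorem act_uncontrollableBlock (x : Vec n) :
    act (basisMatrix w).transpose (act A x) =
      act (uncontrollableBlock A (basisMatrix w)) (act (basisMatrix w).transpose x) := by
  have h : x - act (basisMatrix w) (act (basisMatrix w).transpose x) ∈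
      controllableSubspace A B := by
    rw [← act_basisMatrix_transpose_eq_zero_iff_mem_controllableSubspace A B w, act_sub,
      ← act_mul, basisMatrix_transpose_mul_self, act_one, sub_self]
  have h1 := (act_basisMatrix_transpose_eq_zero_iff_mem_controllableSubspace A B w).2
    (act_mem_controllableSubspace A B h)
  rw [act_sub, act_sub, sub_eq_zero] at h1
  rw [h1, uncontrollableBlock, act_mul, act_mul]

theorem basisMatrix_transpose_mul :
    (basisMatrix w).transpose * A =
      uncontrollableBlock A (basisMatrix w) * (basisMatrix w).transpose := by
  refine Matrix.toEuclideanLin.injective (LinearMap.ext fun x => ?_)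
  have := act_uncontrollableBlock A B w x
  rwa [← act_mul, ← act_mul] at this

end Block

/-! ### Lifting stable solutions -/

section Lift

variable {n l : ℕ}

/-- The coordinatewise real part. -/
def realPart (n : ℕ) : (Fin n → ℂ) →L[ℝ] Vec n :=
  ((EuclideanSpace.equiv (Fin n) ℝ).symm : (Fin n → ℝ) →L[ℝ] Vec n).comp
    (ContinuousLinearMap.pi fun i => Complex.reCLM.comp (ContinuousLinearMap.proj i))

theorem realPart_apply (y : Fin n → ℂ) (i : Fin n) : realPart n y i = (y i).re := rfl

theorem realPart_toLin' (R : Matrix (Fin l) (Fin n) ℝ) (y : Fin n → ℂ) :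
    realPart l (Matrix.toLin' (R.map (fun r : ℝ => (r : ℂ))) y) = act R (realPart n y) := by
  ext i
  rw [realPart_apply, act_apply, Matrix.toLin'_apply, Matrix.mulVec, dotProduct, Complex.re_sum]
  refine Finset.sum_congr rfl fun j _ => ?_
  simp [realPart_apply]

/-- Stable solutions of the quotient system lift to stable solutions. -/
theorem exists_decaying_lift {A : Matrix (Fin n) (Fin n) ℝ} {M : Matrix (Fin l) (Fin l) ℝ}
    {R : Matrix (Fin l) (Fin n) ℝ} {S : Matrix (Fin n) (Fin l) ℝ} (hRS : R * S = 1)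
    (hRA : R * A = M * R) {g : Vec l} (hg : g ∈ stableSpace M) :
    ∃ ξ : ℝ → Vec n, (∀ t, HasDerivAt ξ (act A (ξ t)) t) ∧ act R (ξ 0) = g ∧
      Tendsto ξ atTop (𝓝 0) := by
  have hg' : (fun i => (g i : ℂ)) ∈ complexStableSpace M := hg
  set π := Matrix.toLin' (R.map (fun r : ℝ => (r : ℂ))) with hπ
  have hmul : ∀ {p q r : ℕ} (X : Matrix (Fin p) (Fin q) ℝ) (Y : Matrix (Fin q) (Fin r) ℝ),
      (X * Y).map (fun r : ℝ => (r : ℂ)) =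
        X.map (fun r : ℝ => (r : ℂ)) * Y.map (fun r : ℝ => (r : ℂ)) :=
    fun X Y => Matrix.map_mul (f := Complex.ofRealHom)
  have hsurj : Function.Surjective π := by
    intro y
    refine ⟨Matrix.toLin' (S.map (fun r : ℝ => (r : ℂ))) y, ?_⟩
    rw [hπ, ← Matrix.toLin'_mul_apply, ← hmul, hRS, Matrix.map_one _ (by simp) (by simp)]
    simp
  have hint : ∀ y, π (complexify A y) = complexify M (π y) := by
    intro y
    rw [hπ, complexify, complexify, ← Matrix.toLin'_mul_apply, ← Matrix.toLin'_mul_apply,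
      ← hmul, ← hmul, hRA]
  have key : ∀ w ∈ complexStableSpace M, ∃ φ : ℝ → Fin n → ℂ,
      (∀ t, HasDerivAt φ (complexify A (φ t)) t) ∧ π (φ 0) = w ∧ Tendsto φ atTop (𝓝 0) := by
    intro w hw
    rw [complexStableSpace, iSup_subtype'] at hw
    refine Submodule.iSup_induction _ (motive := fun w => ∃ φ : ℝ → Fin n → ℂ,
      (∀ t, HasDerivAt φ (complexify A (φ t)) t) ∧ π (φ 0) = w ∧ Tendsto φ atTop (𝓝 0)) hw
      ?_ ?_ ?_
    · rintro ⟨μ, hμ⟩ y hy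
      obtain ⟨u, hu, rfl⟩ := exists_mem_maxGenEigenspace_of_surjective hsurj hint hy
      obtain ⟨φ, hφ, h0, hlim⟩ := exists_decaying_solution_of_mem_maxGenEigenspace _ hμ.2 hu
      exact ⟨φ, hφ, by rw [h0], hlim⟩
    · exact ⟨fun _ => 0, fun t => by simpa using hasDerivAt_const t (0 : Fin n → ℂ), by simp,
        tendsto_const_nhds⟩
    · rintro _ _ ⟨φ, hφ, rfl, hl⟩ ⟨ψ, hψ, rfl, hl'⟩
      refine ⟨fun t => φ t + ψ t, fun t => ?_, by simp, by simpa using hl.add hl'⟩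
      rw [map_add]
      exact (hφ t).add (hψ t)
  obtain ⟨φ, hφ, h0, hlim⟩ := key _ hg'
  refine ⟨fun t => realPart n (φ t), fun t => ?_, ?_, ?_⟩
  · rw [← realPart_toLin']
    exact (realPart n).hasFDerivAt.comp_hasDerivAt t (hφ t)
  -- $R$ is real, so it commutes with taking real parts, and the vector $g$ is its own real part.
  · rw [← realPart_toLin', ← hπ, h0]
    ext i
    simp [realPart_apply]
  · have := ((realPart n).continuous.tendsto 0).comp hlim
    rwa [map_zero] at this

end Lift

/-! ### Time averages -/

section Averages

variable {E : Type*} [NormedAddCommGroup E]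

theorem intervalIntegrable_of_memLp {t : ℝ} {g : ℝ → E}
    (hg : MemLp g 2 (volume.restrict (Icc 0 t))) {s : ℝ} (hs : s ∈ Icc 0 t) :
    IntervalIntegrable g volume 0 s := by
  have h : IntegrableOn g (Icc 0 t) := hg.integrable one_le_two
  rw [intervalIntegrable_iff, uIoc_of_le hs.1]
  exact h.mono_set (Ioc_subset_Icc_self.trans (Icc_subset_Icc_right hs.2))

theorem intervalIntegrable_sq_norm_sub {t : ℝ} {g : ℝ → E}
    (hg : MemLp g 2 (volume.restrict (Icc 0 t))) (e : E) {s : ℝ} (hs : s ∈ Icc 0 t) :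
    IntervalIntegrable (fun r => ‖g r - e‖ ^ 2) volume 0 s := by
  have h : IntegrableOn (fun r => ‖g r - e‖ ^ 2) (Icc 0 t) :=
    (hg.sub (memLp_const e)).norm.integrable_sq
  rw [intervalIntegrable_iff, uIoc_of_le hs.1]
  exact h.mono_set (Ioc_subset_Icc_self.trans (Icc_subset_Icc_right hs.2))

theorem memLp_of_continuousOn_Icc {t : ℝ} {g : ℝ → E} (hg : ContinuousOn g (Icc 0 t)) :
    MemLp g 2 (volume.restrict (Icc 0 t)) := by
  obtain ⟨C, hC⟩ := isCompact_Icc.exists_bound_of_continuousOn hg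
  refine MemLp.of_bound (hg.aestronglyMeasurable measurableSet_Icc) C ?_
  exact (ae_restrict_iff' measurableSet_Icc).2 (Eventually.of_forall hC)

theorem tendsto_of_sq_norm_sub_le {α : Type*} {F : Filter α} {a : α → E} {e : E} {G : α → ℝ}
    (hG : Tendsto G F (𝓝 0)) (h : ∀ᶠ T in F, ‖a T - e‖ ^ 2 ≤ G T) : Tendsto a F (𝓝 e) := by
  rw [tendsto_iff_norm_sub_tendsto_zero]
  have h1 : Tendsto (fun T => ‖a T - e‖ ^ 2) F (𝓝 0) :=
    tendsto_of_tendsto_of_tendsto_of_le_of_le' tendsto_const_nhds hG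
      (Eventually.of_forall fun _ => sq_nonneg _) h
  simpa [Real.sqrt_sq (norm_nonneg _)] using h1.sqrt

variable [NormedSpace ℝ E]

/-- Jensen's inequality for time averages. -/
theorem convexOn_average_le [CompleteSpace E] {φ : E → ℝ} (hφ : ConvexOn ℝ univ φ)
    (hc : Continuous φ) {t : ℝ} (ht : 0 < t) {g : ℝ → E} (hg : IntervalIntegrable g volume 0 t)
    (hφg : IntervalIntegrable (fun s => φ (g s)) volume 0 t) :
    φ (t⁻¹ • ∫ s in (0 : ℝ)..t, g s) ≤ t⁻¹ * ∫ s in (0 : ℝ)..t, φ (g s) := by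
  have h := hφ.map_set_average_le hc.continuousOn isClosed_univ (μ := volume) (t := uIoc 0 t)
    (f := g) (by simp [uIoc_of_le ht.le, ht]) (by simp [uIoc_of_le ht.le])
    (by simp) (intervalIntegrable_iff.1 hg) (intervalIntegrable_iff.1 hφg)
  rw [interval_average_eq, interval_average_eq, sub_zero] at h
  exact h

/-- Jensen's inequality for the square of the norm, applied to $g-e$. -/
theorem sq_norm_average_sub_le [CompleteSpace E] {t : ℝ} {g : ℝ → E}
    (hg : MemLp g 2 (volume.restrict (Icc 0 t))) (e : E) {s : ℝ} (hs0 : 0 < s) (hst : s ≤ t) :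
    ‖(s⁻¹ • ∫ r in (0 : ℝ)..s, g r) - e‖ ^ 2 ≤ s⁻¹ * ∫ r in (0 : ℝ)..s, ‖g r - e‖ ^ 2 := by
  have hgi := intervalIntegrable_of_memLp hg ⟨hs0.le, hst⟩
  have h := convexOn_average_le (φ := fun y : E => ‖y‖ ^ 2)
    (convexOn_univ_norm.pow (fun _ _ => norm_nonneg _) 2) (by fun_prop) hs0
    (hgi.sub (intervalIntegrable_const (c := e)))
    (intervalIntegrable_sq_norm_sub hg e ⟨hs0.le, hst⟩)
  have h2 : s⁻¹ • ∫ r in (0 : ℝ)..s, (g r - e) = (s⁻¹ • ∫ r in (0 : ℝ)..s, g r) - e := by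
    rw [intervalIntegral.integral_sub hgi intervalIntegrable_const,
      intervalIntegral.integral_const, smul_sub, sub_zero, smul_smul, inv_mul_cancel₀ hs0.ne',
      one_smul]
  rw [← h2]
  exact h

/-- A convergent continuous function has convergent time averages. -/
theorem tendsto_average_of_tendsto {g : ℝ → ℝ} (hg : Continuous g) {L : ℝ}
    (hL : Tendsto g atTop (𝓝 L)) :
    Tendsto (fun T : ℝ => T⁻¹ * ∫ t in (0 : ℝ)..T, g t) atTop (𝓝 L) := by
  rw [Metric.tendsto_atTop]
  intro ε hε
  obtain ⟨N, hN⟩ := Metric.tendsto_atTop.1 hL (ε / 2) (half_pos hε)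
  set C := |∫ t in (0 : ℝ)..max N 0, (g t - L)| with hC
  have hint : ∀ a b : ℝ, IntervalIntegrable (fun t => g t - L) volume a b := fun a b =>
    (hg.sub continuous_const).intervalIntegrable a b
  -- Beyond this threshold the initial piece contributes $C<\varepsilon T/2$, and the rest
  -- contributes at most $\varepsilon T/2$.
  refine ⟨max N 0 + 2 * C / ε + 1, fun T hT => ?_⟩
  have hC0 : 0 ≤ C := abs_nonneg _
  have h0 : 0 ≤ 2 * C / ε := by positivity
  have hN0 := le_max_right N 0
  have hT0 : 0 < T := by linarith
  have hTN : max N 0 ≤ T := by linarith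
  have hTC : C < ε / 2 * T := by
    have : 2 * C / ε < T := by linarith
    rw [div_lt_iff₀ hε] at this
    linarith
  have h1 : T⁻¹ * ∫ t in (0 : ℝ)..T, g t = T⁻¹ * (∫ t in (0 : ℝ)..T, (g t - L)) + L := by
    rw [intervalIntegral.integral_sub (hg.intervalIntegrable _ _) intervalIntegrable_const,
      intervalIntegral.integral_const, smul_eq_mul]
    field_simp
    ring
  have h2 : |∫ t in max N 0..T, (g t - L)| ≤ ε / 2 * |T - max N 0| := by
    rw [← Real.norm_eq_abs]
    refine intervalIntegral.norm_integral_le_of_norm_le_const fun t ht => ?_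
    rw [uIoc_of_le hTN] at ht
    have := hN t ((le_max_left N 0).trans ht.1.le)
    rw [Real.dist_eq] at this
    exact this.le
  have h3 : |∫ t in (0 : ℝ)..T, (g t - L)| < ε * T := by
    rw [← intervalIntegral.integral_add_adjacent_intervals (hint 0 (max N 0)) (hint _ T)]
    refine (abs_add_le _ _).trans_lt ?_
    rw [abs_of_nonneg (sub_nonneg.2 hTN)] at h2
    nlinarith
  rw [h1, Real.dist_eq, add_sub_cancel_right, abs_mul, abs_of_pos (inv_pos.2 hT0),
    inv_mul_lt_iff₀ hT0, mul_comm T]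
  exact h3

/-- Uniqueness for the integral form of a linear differential equation. -/
theorem eqOn_of_integral_equation [CompleteSpace E] (M : E →L[ℝ] E) {T : ℝ} (hT : 0 ≤ T)
    {y h : ℝ → E} (hy : ContinuousOn y (Icc 0 T))
    (hyi : ∀ t ∈ Icc 0 T, y t = h 0 + ∫ s in (0 : ℝ)..t, M (y s))
    (hh : ∀ t, HasDerivAt h (M (h t)) t) : EqOn y h (Icc 0 T) := by
  -- Extending $y$ by its end values gives a continuous function on the line, whose integral is
  -- differentiable everywhere, end points included.
  set Y : ℝ → E := IccExtend hT ((Icc 0 T).domRestrict y) with hY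
  have hYc : Continuous Y := (continuousOn_iff_continuous_domRestrict.1 hy).Icc_extend'
  have hYy : ∀ t ∈ Icc 0 T, Y t = y t := fun t ht => IccExtend_of_mem _ _ ht
  set Z : ℝ → E := fun t => h 0 + ∫ s in (0 : ℝ)..t, M (Y s) with hZ
  have hZd : ∀ t, HasDerivAt Z (M (Y t)) t := fun t =>
    (intervalIntegral.integral_hasDerivAt_right
      ((M.continuous.comp hYc).intervalIntegrable _ _)
      ((M.continuous.comp hYc).stronglyMeasurableAtFilter _ _)
      (M.continuous.comp hYc).continuousAt).const_add _
  have hZy : ∀ t ∈ Icc 0 T, Z t = y t := by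
    intro t ht
    rw [hyi t ht, hZ]
    refine congrArg (h 0 + ·) (intervalIntegral.integral_congr fun s hs => ?_)
    rw [uIcc_of_le ht.1] at hs
    simp only [hYy s ⟨hs.1, hs.2.trans ht.2⟩]
  -- Grönwall: on $[0,T]$ the derivative of $Z-h$ is $M(Z-h)$, because $Y=Z$ there.
  have h0 : ∀ t ∈ Icc 0 T, Z t - h t = 0 := by
    refine eq_zero_of_abs_deriv_le_mul_abs_self_of_eq_zero_right
      (f' := fun t => M (Y t) - M (h t)) (K := ‖M‖) ?_ (fun t _ => ?_) ?_ fun t ht => ?_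
    · exact fun t _ => ((hZd t).sub (hh t)).continuousAt.continuousWithinAt
    · exact ((hZd t).sub (hh t)).hasDerivWithinAt
    · simp [hZ]
    · rw [← map_sub, hZy t (Ico_subset_Icc_self ht), hYy t (Ico_subset_Icc_self ht)]
      exact M.le_opNorm _
  intro t ht
  rw [← hZy t ht]
  exact sub_eq_zero.1 (h0 t ht)

end Averages

/-! ### Consequences of the integral turnpike property -/

section Turnpike

variable {n m l : ℕ} {A : Matrix (Fin n) (Fin n) ℝ} {B : Matrix (Fin n) (Fin m) ℝ} {b : Vec n}

theorem integral_dynamics {X : ℝ → Vec n} {u : ℝ → Vec m} {t : ℝ}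
    (hX : IntervalIntegrable X volume 0 t) (hu : IntervalIntegrable u volume 0 t) :
    ∫ s in (0 : ℝ)..t, (act A (X s) + act B (u s) + b) =
      act A (∫ s in (0 : ℝ)..t, X s) + act B (∫ s in (0 : ℝ)..t, u s) + t • b := by
  have hA : IntervalIntegrable (fun s => actL A (X s)) volume 0 t :=
    ⟨(actL A).integrable_comp hX.1, (actL A).integrable_comp hX.2⟩
  have hB : IntervalIntegrable (fun s => actL B (u s)) volume 0 t :=
    ⟨(actL B).integrable_comp hu.1, (actL B).integrable_comp hu.2⟩
  simp only [← actL_apply]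
  rw [intervalIntegral.integral_add (hA.add hB) intervalIntegrable_const,
    intervalIntegral.integral_add hA hB, intervalIntegral.integral_const, sub_zero,
    (actL A).intervalIntegral_comp_comm hX, (actL B).intervalIntegral_comp_comm hu]

/-- The mean square deviation of a pair `(X, u)` from `(xs, us)` on `[0, T]`. -/
def meanSqDeviation (T : ℝ) (X : ℝ → Vec n) (u : ℝ → Vec m) (xs : Vec n) (us : Vec m) : ℝ :=
  (1 / T) * ∫ t in (0 : ℝ)..T, (‖X t - xs‖ ^ 2 + ‖u t - us‖ ^ 2)

section Deviation

variable {T : ℝ} {x : Vec n} {X : ℝ → Vec n} {u : ℝ → Vec m} (xs : Vec n) (us : Vec m)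

theorem integral_sq_le_meanSqDeviation (hT : 0 < T) (hX : ContinuousOn X (Icc 0 T))
    (hu : IsControl T u) {g : ℝ → ℝ} (hg : IntervalIntegrable g volume 0 T)
    (hg0 : ∀ t, 0 ≤ g t) (hgle : ∀ t, g t ≤ ‖X t - xs‖ ^ 2 + ‖u t - us‖ ^ 2)
    {a s : ℝ} (ha : 0 ≤ a) (has : a ≤ s) (hs : s ≤ T) :
    ∫ t in a..s, g t ≤ T * meanSqDeviation T X u xs us := by
  have hTT : T ∈ Icc 0 T := ⟨hT.le, le_rfl⟩
  calc ∫ t in a..s, g t ≤ ∫ t in (0 : ℝ)..T, g t :=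
        intervalIntegral.integral_mono_interval ha has hs (Eventually.of_forall hg0) hg
    _ ≤ ∫ t in (0 : ℝ)..T, (‖X t - xs‖ ^ 2 + ‖u t - us‖ ^ 2) :=
        intervalIntegral.integral_mono_on hT.le hg
          ((intervalIntegrable_sq_norm_sub (memLp_of_continuousOn_Icc hX) xs hTT).add
            (intervalIntegrable_sq_norm_sub hu us hTT)) fun t _ => hgle t
    _ = _ := by rw [meanSqDeviation]; field_simp

theorem sq_norm_average_sub_le_meanSqDeviation (hT : 0 < T) (hX : ContinuousOn X (Icc 0 T))
    (hu : IsControl T u) {s : ℝ} (hs : s ∈ Icc (T / 2) T) :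
    ‖(s⁻¹ • ∫ r in (0 : ℝ)..s, X r) - xs‖ ^ 2 ≤ 2 * meanSqDeviation T X u xs us ∧
    ‖(s⁻¹ • ∫ r in (0 : ℝ)..s, u r) - us‖ ^ 2 ≤ 2 * meanSqDeviation T X u xs us := by
  have hs0 : 0 < s := (half_pos hT).trans_le hs.1
  have hTT : T ∈ Icc 0 T := ⟨hT.le, le_rfl⟩
  have hD : 0 ≤ meanSqDeviation T X u xs us :=
    mul_nonneg (by positivity) (intervalIntegral.integral_nonneg hT.le fun t _ => by positivity)
  -- The factor $2$ comes from $s\ge T/2$, that is $T/s\le2$.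
  have key : ∀ I : ℝ, I ≤ T * meanSqDeviation T X u xs us →
      s⁻¹ * I ≤ 2 * meanSqDeviation T X u xs us := by
    intro I hI
    rw [inv_mul_le_iff₀ hs0]
    nlinarith [hs.1]
  have hX2 := memLp_of_continuousOn_Icc hX
  exact ⟨(sq_norm_average_sub_le hX2 xs hs0 hs.2).trans (key _
      (integral_sq_le_meanSqDeviation xs us hT hX hu
        (intervalIntegrable_sq_norm_sub hX2 xs hTT) (fun t => sq_nonneg _)
        (fun t => le_add_of_nonneg_right (sq_nonneg _)) le_rfl hs0.le hs.2)),
    (sq_norm_average_sub_le hu us hs0 hs.2).trans (key _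
      (integral_sq_le_meanSqDeviation xs us hT hX hu
        (intervalIntegrable_sq_norm_sub hu us hTT) (fun t => sq_nonneg _)
        (fun t => le_add_of_nonneg_left (sq_nonneg _)) le_rfl hs0.le hs.2))⟩

/-- Some point of $(T/2,T]$ does not exceed the average over that interval, whose length $T/2$
produces the factor $2$. Staying beyond $T/2$ makes the chosen times tend to infinity with $T$. -/
theorem exists_sq_norm_sub_le_meanSqDeviation (hT : 0 < T) (hX : ContinuousOn X (Icc 0 T))
    (hu : IsControl T u) :
    ∃ s ∈ Icc (T / 2) T, ‖X s - xs‖ ^ 2 ≤ 2 * meanSqDeviation T X u xs us := by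
  have hTT : T ∈ Icc 0 T := ⟨hT.le, le_rfl⟩
  have hlt : T / 2 < T := half_lt_self hT
  have hg := intervalIntegrable_sq_norm_sub (memLp_of_continuousOn_Icc hX) xs hTT
  obtain ⟨s, hs, h⟩ := exists_le_setAverage (μ := volume) (s := uIoc (T / 2) T)
    (f := fun r => ‖X r - xs‖ ^ 2) (by simp [uIoc_of_le hlt.le, hT])
    (by simp [uIoc_of_le hlt.le]) ((intervalIntegrable_iff.1 hg).mono_set (by
      rw [uIoc_of_le hlt.le, uIoc_of_le hT.le]
      exact Ioc_subset_Ioc_left (half_pos hT).le))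
  rw [uIoc_of_le hlt.le] at hs
  refine ⟨s, Ioc_subset_Icc_self hs, h.trans ?_⟩
  rw [interval_average_eq, smul_eq_mul, inv_mul_le_iff₀ (by linarith)]
  refine (integral_sq_le_meanSqDeviation xs us hT hX hu hg (fun t => sq_nonneg _)
    (fun t => le_add_of_nonneg_right (sq_nonneg _)) (half_pos hT).le hlt.le le_rfl).trans
      (le_of_eq (by ring))

end Deviation

/-- A steady pair of the turnpike property is an equilibrium. -/
theorem act_add_act_add_eq_zero {x xs : Vec n} {us : Vec m} {X : ℝ → ℝ → Vec n}
    {u : ℝ → ℝ → Vec m} {τ : ℝ → ℝ}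
    (hX : ∀ᶠ T in atTop, IsTrajectory A B b T x (u T) (X T))
    (hu : ∀ᶠ T in atTop, IsControl T (u T))
    (hlim : Tendsto (fun T => meanSqDeviation T (X T) (u T) xs us) atTop (𝓝 0))
    (hτ : ∀ᶠ T in atTop, τ T ∈ Icc (T / 2) T)
    (hXτ : Tendsto (fun T => X T (τ T)) atTop (𝓝 xs)) :
    act A xs + act B us + b = 0 := by
  have hlim2 : Tendsto (fun T => 2 * meanSqDeviation T (X T) (u T) xs us) atTop (𝓝 0) := by
    simpa using hlim.const_mul 2
  have hτtop : Tendsto τ atTop atTop :=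
    tendsto_atTop_mono' _ (hτ.mono fun T h => h.1) (tendsto_id.atTop_div_const two_pos)
  have hXav : Tendsto (fun T => (τ T)⁻¹ • ∫ r in (0 : ℝ)..τ T, X T r) atTop (𝓝 xs) := by
    refine tendsto_of_sq_norm_sub_le hlim2 ?_
    filter_upwards [hX, hu, hτ, eventually_gt_atTop 0] with T hXT huT hτT hT
    exact (sq_norm_average_sub_le_meanSqDeviation xs us hT hXT.1 huT hτT).1
  have huav : Tendsto (fun T => (τ T)⁻¹ • ∫ r in (0 : ℝ)..τ T, u T r) atTop (𝓝 us) := by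
    refine tendsto_of_sq_norm_sub_le hlim2 ?_
    filter_upwards [hX, hu, hτ, eventually_gt_atTop 0] with T hXT huT hτT hT
    exact (sq_norm_average_sub_le_meanSqDeviation xs us hT hXT.1 huT hτT).2
  -- The average of $\dot X_T$ over $[0,\tau(T)]$ vanishes in the limit, because $X_T(\tau(T))$
  -- converges while $\tau(T)\to\infty$.
  have h1 : Tendsto (fun T => (τ T)⁻¹ • (X T (τ T) - x)) atTop (𝓝 ((0 : ℝ) • (xs - x))) :=
    hτtop.inv_tendsto_atTop.smul (hXτ.sub_const x)
  rw [zero_smul] at h1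
  have h2 := (((((actL A).continuous.tendsto xs).comp hXav).add
    (((actL B).continuous.tendsto us).comp huav)).add_const b)
  refine tendsto_nhds_unique h2 (h1.congr' ?_)
  filter_upwards [hX, hu, hτ, eventually_gt_atTop 0] with T hXT huT hτT hT
  have hτ0 : 0 < τ T := (half_pos hT).trans_le hτT.1
  have hmem : τ T ∈ Icc 0 T := ⟨hτ0.le, hτT.2⟩
  rw [hXT.2 _ hmem, add_sub_cancel_left, integral_dynamics
    (intervalIntegrable_of_memLp (memLp_of_continuousOn_Icc hXT.1) hmem)
    (intervalIntegrable_of_memLp huT hmem), smul_add, smul_add, smul_smul,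
    inv_mul_cancel₀ hτ0.ne', one_smul]
  simp only [Function.comp, map_smul, actL_apply]

/-- The uncontrollable part of every trajectory is the same solution of a linear system. -/
theorem IsTrajectory.uncontrollable_part {M : Matrix (Fin l) (Fin l) ℝ}
    {R : Matrix (Fin l) (Fin n) ℝ} (hRB : ∀ w, act R (act B w) = 0)
    (hRA : ∀ y, act R (act A y) = act M (act R y)) {c : Vec l} (hc : act M c = act R b)
    {T : ℝ} (hT : 0 ≤ T) {x : Vec n} {u : ℝ → Vec m} {X : ℝ → Vec n}
    (hX : IsTrajectory A B b T x u X) (hu : IsControl T u) {h : ℝ → Vec l}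
    (hh : ∀ t, HasDerivAt h (act M (h t)) t) (h0 : h 0 = act R x + c) {t : ℝ}
    (ht : t ∈ Icc 0 T) : act R (X t) + c = h t := by
  refine eqOn_of_integral_equation (actL M) hT (y := fun t => act R (X t) + c)
    (((actL R).continuous.comp_continuousOn hX.1).add continuousOn_const) (fun t ht => ?_) hh ht
  have hXi := intervalIntegrable_of_memLp (memLp_of_continuousOn_Icc hX.1) ht
  have hui := intervalIntegrable_of_memLp hu ht
  have hRX : IntervalIntegrable (fun s => actL R (X s)) volume 0 t :=
    ⟨(actL R).integrable_comp hXi.1, (actL R).integrable_comp hXi.2⟩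
  have h1 : ∫ s in (0 : ℝ)..t, (act R (X s) + c) = act R (∫ s in (0 : ℝ)..t, X s) + t • c := by
    simp only [← actL_apply]
    rw [intervalIntegral.integral_add hRX intervalIntegrable_const,
      intervalIntegral.integral_const, sub_zero, (actL R).intervalIntegral_comp_comm hXi]
  have hRXc : IntervalIntegrable (fun s => act R (X s) + c) volume 0 t :=
    hRX.add intervalIntegrable_const
  rw [(actL M).intervalIntegral_comp_comm hRXc, h1, hX.2 t ht, integral_dynamics hXi hui, h0,
    actL_apply]
  simp only [map_add, act, map_smul] at hc hRA hRB ⊢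
  rw [hRB, hRA, hc]
  abel

/-- A solution of the homogeneous system started at `x - z` is a correction of the equilibrium
`(z, w)` to a trajectory started at `x`. -/
theorem isTrajectory_of_equilibrium {x z : Vec n} {w : Vec m} (hz : act A z + act B w + b = 0)
    {ξ : ℝ → Vec n} {η : ℝ → Vec m} (hη : Continuous η)
    (hξ : ∀ t, HasDerivAt ξ (actL A (ξ t) + actL B (η t)) t) (h0 : ξ 0 = x - z) (T : ℝ) :
    IsTrajectory A B b T x (fun t => w + η t) (fun t => z + ξ t) := by
  have hξc : Continuous ξ := continuous_iff_continuousAt.2 fun t => (hξ t).continuousAt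
  refine ⟨(continuous_const.add hξc).continuousOn, fun t _ => ?_⟩
  have h1 : ∀ s, act A (z + ξ s) + act B (w + η s) + b = actL A (ξ s) + actL B (η s) := by
    intro s
    rw [act_add, act_add, actL_apply, actL_apply, ← sub_eq_zero, ← hz]
    abel
  simp only [h1]
  rw [intervalIntegral.integral_eq_sub_of_hasDerivAt (fun s _ => hξ s)
    ((((actL A).continuous.comp hξc).add ((actL B).continuous.comp hη)).intervalIntegrable _ _),
    h0]
  abel

/-- An optimal pair costs at most as much as any pair with integrable cost. -/
theorem IsOptimalPair.integral_le {f : Vec n × Vec m → ℝ} {T : ℝ} {x : Vec n} {X Y : ℝ → Vec n}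
    {u v : ℝ → Vec m} (h : IsOptimalPair A B b f T x X u) (hv : IsControl T v)
    (hY : IsTrajectory A B b T x v Y)
    (hf : IntervalIntegrable (fun t => f (Y t, v t)) volume 0 T) :
    IntervalIntegrable (fun t => f (X t, u t)) volume 0 T ∧
      ∫ t in (0 : ℝ)..T, f (X t, u t) ≤ ∫ t in (0 : ℝ)..T, f (Y t, v t) := by
  have hle : cost f T X u ≤ cost f T Y v := by
    rw [h.2.2]
    exact sInf_le ⟨v, Y, hv, hY, rfl⟩
  rw [cost, cost, if_pos hf] at hle
  -- A finite competitor cost excludes the value $+\infty$, so the optimal integrand is integrable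
  -- and Jensen applies to it.
  split_ifs at hle with hi
  · exact ⟨hi, EReal.coe_le_coe_iff.1 hle⟩
  · exact absurd (top_le_iff.1 hle) (EReal.coe_ne_top _)

theorem integral_prodMk {X : ℝ → Vec n} {u : ℝ → Vec m} {t : ℝ}
    (hX : IntervalIntegrable X volume 0 t) (hu : IntervalIntegrable u volume 0 t) :
    ∫ s in (0 : ℝ)..t, (X s, u s) = (∫ s in (0 : ℝ)..t, X s, ∫ s in (0 : ℝ)..t, u s) := by
  have h : IntervalIntegrable (fun s => (X s, u s)) volume 0 t :=
    ⟨hX.1.prodMk hu.1, hX.2.prodMk hu.2⟩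
  refine Prod.ext ?_ ?_
  · exact ((ContinuousLinearMap.fst ℝ (Vec n) (Vec m)).intervalIntegral_comp_comm h).symm
  · exact ((ContinuousLinearMap.snd ℝ (Vec n) (Vec m)).intervalIntegral_comp_comm h).symm

/-- The steady pair of the turnpike property is at least as good as every equilibrium that the
initial state can be steered to. -/
theorem le_of_equilibrium {f : Vec n × Vec m → ℝ} (hf : ConvexOn ℝ univ f) {x xs : Vec n}
    {us : Vec m} {X : ℝ → ℝ → Vec n} {u : ℝ → ℝ → Vec m}
    (hopt : ∀ᶠ T in atTop, IsOptimalPair A B b f T x (X T) (u T))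
    (hlim : Tendsto (fun T => meanSqDeviation T (X T) (u T) xs us) atTop (𝓝 0))
    {z : Vec n} {w : Vec m} (hz : act A z + act B w + b = 0)
    (hxz : x - z ∈ decayingStates (actL A) (actL B)) : f (xs, us) ≤ f (z, w) := by
  have hfc : Continuous f := continuousOn_univ.1 (hf.continuousOn isOpen_univ)
  obtain ⟨ξ, η, hη, hξ, h0, hξlim, hηlim⟩ := hxz
  have hξc : Continuous ξ := continuous_iff_continuousAt.2 fun t => (hξ t).continuousAt
  have hcomp : Continuous fun t => f (z + ξ t, w + η t) := by fun_prop
  have hcomplim : Tendsto (fun t => f (z + ξ t, w + η t)) atTop (𝓝 (f (z, w))) := by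
    have h1 := (hξlim.const_add z).prodMk_nhds (hηlim.const_add w)
    rw [add_zero, add_zero] at h1
    exact (hfc.tendsto _).comp h1
  have hlim2 : Tendsto (fun T => 2 * meanSqDeviation T (X T) (u T) xs us) atTop (𝓝 0) := by
    simpa using hlim.const_mul 2
  have hXav : Tendsto (fun T => T⁻¹ • ∫ r in (0 : ℝ)..T, X T r) atTop (𝓝 xs) := by
    refine tendsto_of_sq_norm_sub_le hlim2 ?_
    filter_upwards [hopt, eventually_gt_atTop 0] with T h hT
    exact (sq_norm_average_sub_le_meanSqDeviation xs us hT h.2.1.1 h.1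
      ⟨(half_lt_self hT).le, le_rfl⟩).1
  have huav : Tendsto (fun T => T⁻¹ • ∫ r in (0 : ℝ)..T, u T r) atTop (𝓝 us) := by
    refine tendsto_of_sq_norm_sub_le hlim2 ?_
    filter_upwards [hopt, eventually_gt_atTop 0] with T h hT
    exact (sq_norm_average_sub_le_meanSqDeviation xs us hT h.2.1.1 h.1
      ⟨(half_lt_self hT).le, le_rfl⟩).2
  refine le_of_tendsto_of_tendsto ((hfc.tendsto _).comp (hXav.prodMk_nhds huav))
    (tendsto_average_of_tendsto hcomp hcomplim) ?_
  filter_upwards [hopt, eventually_gt_atTop 0] with T h hT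
  have hTT : T ∈ Icc 0 T := ⟨hT.le, le_rfl⟩
  obtain ⟨hint, hle⟩ := h.integral_le
    (memLp_of_continuousOn_Icc (continuous_const.add hη).continuousOn)
    (isTrajectory_of_equilibrium hz hη hξ h0 T) (hcomp.intervalIntegrable _ _)
  have hXi := intervalIntegrable_of_memLp (memLp_of_continuousOn_Icc h.2.1.1) hTT
  have hui := intervalIntegrable_of_memLp h.1 hTT
  have hJ := convexOn_average_le hf hfc hT (g := fun t => (X T t, u T t))
    ⟨hXi.1.prodMk hui.1, hXi.2.prodMk hui.2⟩ hint
  rw [integral_prodMk hXi hui] at hJ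
  exact hJ.trans (mul_le_mul_of_nonneg_left hle (inv_nonneg.2 hT.le))

end Turnpike

/-- The component of a vector of `𝒢₁ ⊕ 𝒢₂` in `𝒢₁`. -/
theorem sub_projKernel_mem_stableSpace {l : ℕ} (M : Matrix (Fin l) (Fin l) ℝ)
    (y : ↥(stableSpace M ⊔ kernelSpace M)) :
    (y : Vec l) - (projKernel M y : Vec l) ∈ stableSpace M :=
  Submodule.sub_projection_mem (isCompl_stableSpace_kernelSpace M) y

theorem act_projKernel {l : ℕ} (M : Matrix (Fin l) (Fin l) ℝ)
    (y : ↥(stableSpace M ⊔ kernelSpace M)) : act M (projKernel M y : Vec l) = 0 :=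
  Submodule.projection_apply_mem (isCompl_stableSpace_kernelSpace M) y

end LinearConvex

end

/-! ### The proposition -/

open LinearConvex in
theorem mainTheorem5 {n m l : ℕ}
    (A : Matrix (Fin n) (Fin n) ℝ) (B : Matrix (Fin n) (Fin m) ℝ) (b : LinearConvex.Vec n)
    (v : OrthonormalBasis (Fin l) ℝ ↥(LinearConvex.controllableSubspace A B)ᗮ)
    (hA1 : b ∈ LinearConvex.image (Matrix.fromCols A B))
    (c : LinearConvex.Vec l)
    (hc : LinearConvex.act (LinearConvex.uncontrollableBlock A (LinearConvex.basisMatrix v)) c =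
      LinearConvex.act (LinearConvex.basisMatrix v).transpose b)
    (f : LinearConvex.Vec n × LinearConvex.Vec m → ℝ) (hf : ConvexOn ℝ Set.univ f)
    (x : LinearConvex.Vec n)
    (hx : x ∈ LinearConvex.feasibleStates A (LinearConvex.basisMatrix v) c)
    (xs : LinearConvex.Vec n) (us : LinearConvex.Vec m)
    (hturnpike : LinearConvex.HasIntegralTurnpike A B b f x xs us) :
    (xs, us) ∈ LinearConvex.constraintSet A B b (LinearConvex.basisMatrix v) c x hx ∧
      ∀ p ∈ LinearConvex.constraintSet A B b (LinearConvex.basisMatrix v) c x hx,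
        f (xs, us) ≤ f p := by
  obtain ⟨X, u, hopt, hlim⟩ := hturnpike
  change Tendsto (fun T => meanSqDeviation T (X T) (u T) xs us) atTop (𝓝 0) at hlim
  set M := uncontrollableBlock A (basisMatrix v)
  set R := (basisMatrix v).transpose
  set g : Vec l := (projKernel M ⟨act R x + c, hx⟩ : Vec l)
  obtain ⟨ξ, hξ, hξ0, hξlim⟩ := exists_decaying_lift (basisMatrix_transpose_mul_self v)
    (basisMatrix_transpose_mul A B v) (sub_projKernel_mem_stableSpace M ⟨act R x + c, hx⟩)
  change act R (ξ 0) = act R x + c - g at hξ0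
  have hRA : ∀ y, act R (act A y) = act M (act R y) := act_uncontrollableBlock A B v
  constructor
  · have hτ : ∀ T, ∃ s, 0 < T → IsOptimalPair A B b f T x (X T) (u T) →
        s ∈ Icc (T / 2) T ∧ ‖X T s - xs‖ ^ 2 ≤ 2 * meanSqDeviation T (X T) (u T) xs us := by
      intro T
      by_cases h : 0 < T ∧ IsOptimalPair A B b f T x (X T) (u T)
      · obtain ⟨s, hs⟩ := exists_sq_norm_sub_le_meanSqDeviation xs us h.1 h.2.2.1.1 h.2.1
        exact ⟨s, fun _ _ => hs⟩
      -- A default value, so that $\tau$ is defined for every $T$; only large $T$ matter.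
      · exact ⟨0, fun h1 h2 => absurd ⟨h1, h2⟩ h⟩
    choose τ hτ using hτ
    have hτmem : ∀ᶠ T in atTop, τ T ∈ Icc (T / 2) T := by
      filter_upwards [hopt, eventually_gt_atTop 0] with T h hT
      exact (hτ T hT h).1
    have hXτ : Tendsto (fun T => X T (τ T)) atTop (𝓝 xs) := by
      refine tendsto_of_sq_norm_sub_le (G := fun T => 2 * meanSqDeviation T (X T) (u T) xs us)
        (by simpa using Tendsto.const_mul 2 hlim) ?_
      filter_upwards [hopt, eventually_gt_atTop 0] with T h hT
      exact (hτ T hT h).2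
    refine ⟨act_add_act_add_eq_zero (hopt.mono fun T h => h.2.1) (hopt.mono fun T h => h.1)
      hlim hτmem hXτ, ?_⟩
    change act R xs + c = g
    have hτtop : Tendsto τ atTop atTop :=
      tendsto_atTop_mono' _ (hτmem.mono fun T h => h.1) (tendsto_id.atTop_div_const two_pos)
    have h1 : Tendsto (fun T => act R (X T (τ T)) + c) atTop (𝓝 (act R xs + c)) :=
      (((actL R).continuous.tendsto xs).comp hXτ).add_const c
    have h2 : Tendsto (fun T => g + act R (ξ (τ T))) atTop (𝓝 (g + act R 0)) :=
      (((actL R).continuous.tendsto 0).comp (hξlim.comp hτtop)).const_add g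
    rw [act, map_zero, add_zero] at h2
    refine tendsto_nhds_unique h1 (h2.congr' ?_)
    filter_upwards [hopt, hτmem, eventually_gt_atTop 0] with T h hτT hT
    -- The solution of $y'=My$ started at $Rx+c$ is $g+R\xi$, since $Mg=0$ and $RA=MR$.
    refine (h.2.1.uncontrollable_part (act_basisMatrix_transpose_act_input A B v) hRA hc hT.le
      h.1 (h := fun t => g + act R (ξ t)) (fun t => ?_) ?_
      ⟨(half_pos hT).le.trans hτT.1, hτT.2⟩).symm
    · rw [act_add, act_projKernel, zero_add, ← hRA]
      exact (((actL R).hasFDerivAt.comp_hasDerivAt t (hξ t)).const_add g)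
    · rw [hξ0]
      abel
  · rintro ⟨z, w⟩ ⟨hz, hzg⟩
    refine le_of_equilibrium hf hopt hlim hz ?_
    have h1 : ξ 0 ∈ decayingStates (actL A) (actL B) :=
      ⟨ξ, fun _ => 0, continuous_const, fun t => by
        rw [map_zero, add_zero]
        exact hξ t, rfl, hξlim,
        tendsto_const_nhds⟩
    -- Both $R(x-z)$ and $R\xi(0)$ equal $Rx+c-g$, by the constraint on $z$ and the choice of $\xi$.
    have h2 : x - z - ξ 0 ∈ controllableSubspace A B := by
      rw [← act_basisMatrix_transpose_eq_zero_iff_mem_controllableSubspace A B v, act_sub,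
        act_sub]
      change act R x - act R z - act R (ξ 0) = 0
      change act R z + c = g at hzg
      rw [hξ0, ← hzg]
      abel
    have h3 := Submodule.add_mem _ (controllableSubspace_le_decayingStates A B h2) h1
    rwa [sub_add_cancel] at h3
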